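/- Let $D$ be a finite digraph without loops and without parallel arcs, on $n$ vertices. An out-tree of $D$ is a subgraph $T$ of $D$ whose underlying undirected graph is a tree and in which one vertex, the root, has in-degree $0$ and every other vertex has in-degree exactly $1$; an out-branching of $D$ is an out-tree that contains all vertices of $D$. A leaf of an out-tree $T$ is a vertex of out-degree $0$ in $T$, and $\ell(D)$ denotes the maximum number of leaves over all out-trees of $D$. Suppose that $D$ has at least one out-branching. If every vertex of $D$ has in-degree at least $3$, or if $D$ is an oriented graph (that is, $(u,v)$ and $(v,u)$ are never both arcs of $D$) in which every vertex has in-degree at least $2$, then $$\ell(D)\ \ge\ \tfrac14\sqrt{n}.$$ -/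

import Mathlib

namespace Digraph

/-- A subgraph of a digraph `D`: a set of vertices and a set of arcs of `D` between them. -/
structure Subdigraph {V : Type*} (D : Digraph V) where
  verts : Set V
  Adj : V → V → Prop
  adj_sub : ∀ {u v : V}, Adj u v → D.Adj u v
  tail_mem : ∀ {u v : V}, Adj u v → u ∈ verts
  head_mem : ∀ {u v : V}, Adj u v → v ∈ verts

/-- The in-degree of a vertex. -/
noncomputable def inDegree {V : Type*} (D : Digraph V) (v : V) : ℕ :=
  {u | D.Adj u v}.ncard

/-- `D` is an oriented graph: `(u, v)` and `(v, u)` are never both arcs. -/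
def IsOriented {V : Type*} (D : Digraph V) : Prop :=
  ∀ u v : V, D.Adj u v → ¬ D.Adj v u

namespace Subdigraph

variable {V : Type*} {D : Digraph V}

/-- A subgraph, viewed as a digraph on its own vertex set. -/
def coe (T : D.Subdigraph) : Digraph T.verts where
  Adj u v := T.Adj u v

/-- `T` is an out-tree with root `r`: the undirected graph underlying `T` is a tree, `r` has no
in-neighbour in `T`, and every other vertex of `T` has exactly one in-neighbour in `T`. -/
structure IsOutTreeWithRoot (T : D.Subdigraph) (r : V) : Prop where
  isTree : T.coe.toSimpleGraphInclusive.IsTree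
  root_mem : r ∈ T.verts
  root_in : ∀ u : V, ¬ T.Adj u r
  in_unique : ∀ v ∈ T.verts, v ≠ r → ∃! u : V, T.Adj u v

/-- `T` is an out-tree of `D`. -/
def IsOutTree (T : D.Subdigraph) : Prop :=
  ∃ r : V, T.IsOutTreeWithRoot r

/-- `T` is an out-branching of `D`: a spanning out-tree. -/
def IsOutBranching (T : D.Subdigraph) : Prop :=
  T.IsOutTree ∧ T.verts = Set.univ

/-- The leaves of `T`: its vertices of out-degree zero in `T`. -/
def leaves (T : D.Subdigraph) : Set V :=
  {v | v ∈ T.verts ∧ ∀ w : V, ¬ T.Adj v w}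

end Subdigraph

/-- `ℓ(D)`: the maximum number of leaves over all out-trees of `D`. -/
noncomputable def maxLeaves {V : Type*} (D : Digraph V) : ℕ :=
  sSup {k | ∃ T : D.Subdigraph, T.IsOutTree ∧ T.leaves.ncard = k}

/-- For a finite nonempty digraph the supremum that defines `maxLeaves` is a maximum. -/
theorem isGreatest_maxLeaves {V : Type*} [Finite V] [Nonempty V] (D : Digraph V) :
    IsGreatest {k | ∃ T : D.Subdigraph, T.IsOutTree ∧ T.leaves.ncard = k} D.maxLeaves := by
  have hb : BddAbove {k | ∃ T : D.Subdigraph, T.IsOutTree ∧ T.leaves.ncard = k} := by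
    refine ⟨Nat.card V, ?_⟩
    rintro k ⟨T, -, rfl⟩
    exact Set.ncard_le_card _
  refine ⟨Nat.sSup_mem ?_ hb, fun k hk => le_csSup hb hk⟩
  obtain ⟨r⟩ := ‹Nonempty V›
  let T : D.Subdigraph :=
    { verts := {r}
      Adj := fun _ _ => False
      adj_sub := fun h => h.elim
      tail_mem := fun h => h.elim
      head_mem := fun h => h.elim }
  have : Subsingleton T.verts := by
    change Subsingleton ({r} : Set V)
    infer_instance
  have : Nonempty T.verts := ⟨⟨r, rfl⟩⟩
  exact ⟨_, T, ⟨r, ⟨SimpleGraph.IsTree.of_subsingleton, rfl, fun _ h => h,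
    fun v hv hne => absurd hv hne⟩⟩, rfl⟩

end Digraph

/-! Write ℓ for `D.maxLeaves`. Among the out-branchings with a fixed root, take one with the most
leaves. Fewer than 2ℓ of its vertices have a number of children other than one, and every vertex
lies on a branchless path ending at such a vertex. If these paths have at most 8ℓ + 2 arcs
(`length_path_le`), then n ≤ (2ℓ - 1)(8ℓ + 3) ≤ 16ℓ².

By maximality, an inner vertex of such a path has an in-neighbour outside the subtree of the path,
or in the subtree of its bottom, or on the path at least two steps below
(`exists_inNeighbor_of_path`): hanging it instead from a higher path vertex would make its parent a
new leaf. Cut the path at the lowest inner vertex with an in-neighbour outside. Each of the two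
stretches attaches to an out-tree, and `length_le_of_inNeighbors` bounds its size by 4ℓ: four
extensions of that out-tree have together at least as many leaves as the stretch has vertices. -/

namespace Digraph

/-! ### Out-trees as ranked parent functions. -/

variable {V : Type*} {D : Digraph V}

/-- `par` assigns to every vertex of `A` other than `r` an in-neighbour in `A`, without cycles:
the arcs `(par v, v)` form an out-tree with vertex set `A` and root `r`. -/
structure IsArborescence (D : Digraph V) (A : Set V) (r : V) (par : V → V) (ρ : V → ℕ) : Prop where
  root_mem : r ∈ A
  par_mem : ∀ v ∈ A, v ≠ r → par v ∈ A
  adj : ∀ v ∈ A, v ≠ r → D.Adj (par v) v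
  rank_lt : ∀ v ∈ A, v ≠ r → ρ (par v) < ρ v

/-- The vertices of `A` that are not the parent of a vertex of `A`. -/
def parentLeaves (A : Set V) (r : V) (par : V → V) : Set V :=
  {v | v ∈ A ∧ ∀ w ∈ A, w ≠ r → par w ≠ v}

namespace IsArborescence

variable {A : Set V} {r : V} {par : V → V} {ρ : V → ℕ}

/-- The subgraph formed by the arcs `(par v, v)`. -/
def toSubdigraph (h : IsArborescence D A r par ρ) : D.Subdigraph where
  verts := A
  Adj u v := v ∈ A ∧ v ≠ r ∧ u = par v
  adj_sub := by
    rintro u v ⟨hv, hr, rfl⟩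
    exact h.adj v hv hr
  tail_mem := by
    rintro u v ⟨hv, hr, rfl⟩
    exact h.par_mem v hv hr
  head_mem := fun hv => hv.1

/-- Induction on the rank connects every vertex to the root, and each edge comes from a non-root
vertex and its parent, so there are fewer edges than vertices. -/
theorem toSubdigraph_isOutTree [Finite V] (h : IsArborescence D A r par ρ) :
    h.toSubdigraph.IsOutTree := by
  classical
  have hadj : ∀ v (hv : v ∈ A) (hr : v ≠ r),
      h.toSubdigraph.coe.toSimpleGraphInclusive.Adj ⟨par v, h.par_mem v hv hr⟩ ⟨v, hv⟩ := by
    intro v hv hr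
    refine ⟨fun he => ?_, Or.inl ⟨hv, hr, rfl⟩⟩
    have h1 := h.rank_lt v hv hr
    rw [show par v = v from congrArg Subtype.val he] at h1
    exact lt_irrefl _ h1
  refine ⟨r, ?_, h.root_mem, fun u hu => hu.2.1 rfl, fun v hv hr => ⟨par v, ⟨hv, hr, rfl⟩,
    fun u hu => hu.2.2⟩⟩
  have hreach : ∀ n v (hv : v ∈ A), ρ v = n →
      h.toSubdigraph.coe.toSimpleGraphInclusive.Reachable ⟨r, h.root_mem⟩ ⟨v, hv⟩ := by
    intro n
    induction n using Nat.strong_induction_on with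
    | _ n ih =>
      intro v hv hn
      by_cases hr : v = r
      · subst hr
        exact SimpleGraph.Reachable.refl _
      · exact (ih _ (hn ▸ h.rank_lt v hv hr) _ (h.par_mem v hv hr) rfl).trans
          (hadj v hv hr).reachable
  have hconn : h.toSubdigraph.coe.toSimpleGraphInclusive.Connected :=
    SimpleGraph.connected_iff_exists_forall_reachable _ |>.2
      ⟨⟨r, h.root_mem⟩, fun v => hreach _ v.1 v.2 rfl⟩
  refine SimpleGraph.isTree_iff_connected_and_card.2 ⟨hconn,
    le_antisymm ?_ hconn.card_vert_le_card_edgeSet_add_one⟩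
  let F : {v : A // v.1 ≠ r} → Sym2 A := fun v =>
    s(⟨par v.1.1, h.par_mem _ v.1.2 v.2⟩, v.1)
  have hsub : h.toSubdigraph.coe.toSimpleGraphInclusive.edgeSet ⊆ Set.range F := by
    intro e
    induction e with
    | _ a b =>
      rintro ⟨-, h1 | h1⟩
      · obtain ⟨hb, hr, he⟩ := h1
        exact ⟨⟨b, hr⟩, by simp only [F, ← he]; rfl⟩
      · obtain ⟨hb, hr, he⟩ := h1
        exact ⟨⟨a, hr⟩, by simp only [F, ← he]; exact Sym2.eq_swap⟩
  have h1 : Nat.card h.toSubdigraph.coe.toSimpleGraphInclusive.edgeSet ≤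
      Nat.card {v : A // v.1 ≠ r} :=
    (Nat.card_mono (Set.toFinite _) hsub).trans (Finite.card_range_le F)
  have h2 : Nat.card {v : A // v.1 ≠ r} < Nat.card h.toSubdigraph.verts :=
    Finite.card_subtype_lt (x := ⟨r, h.root_mem⟩) (by simp)
  omega

theorem card_parentLeaves_le [Finite V] (h : IsArborescence D A r par ρ) :
    (parentLeaves A r par).ncard ≤ D.maxLeaves := by
  have : Nonempty V := ⟨r⟩
  refine (isGreatest_maxLeaves D).2 ⟨_, h.toSubdigraph_isOutTree, congrArg Set.ncard ?_⟩
  ext v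
  refine and_congr Iff.rfl ⟨fun h1 w hw hr he => h1 w ⟨hw, hr, he.symm⟩, ?_⟩
  rintro h1 w ⟨hw, hr, he⟩
  exact h1 w hw hr he.symm

end IsArborescence

/-- Reaching `r` by iterating `par` passes along each arc in both directions, so connectedness gives
it for all vertices; the rank is the number of iterations needed. -/
theorem Subdigraph.IsOutBranching.exists_isArborescence {T : D.Subdigraph}
    (hT : T.IsOutBranching) : ∃ r par ρ, IsArborescence D Set.univ r par ρ := by
  classical
  obtain ⟨⟨r, h⟩, huniv⟩ := hT
  have hex : ∀ v, ∃ u, v ≠ r → T.Adj u v ∧ ∀ w, T.Adj w v → w = u := by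
    intro v
    by_cases hr : v = r
    · exact ⟨r, fun h1 => absurd hr h1⟩
    · obtain ⟨u, hu, hu'⟩ := h.in_unique v (huniv ▸ Set.mem_univ v) hr
      exact ⟨u, fun _ => ⟨hu, hu'⟩⟩
  choose par hpar using hex
  have hstep : ∀ u v, T.Adj u v →
      ((∃ n, par^[n] u = r) ↔ ∃ n, par^[n] v = r) := by
    intro u v huv
    have hr : v ≠ r := by
      rintro rfl
      exact h.root_in _ huv
    have hu : u = par v := (hpar v hr).2 u huv
    subst hu
    constructor
    · rintro ⟨n, hn⟩
      exact ⟨n + 1, hn⟩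
    · rintro ⟨_ | n, hn⟩
      · exact absurd hn hr
      · exact ⟨n, hn⟩
  have hwalk : ∀ a b : T.verts, T.coe.toSimpleGraphInclusive.Reachable a b →
      (∃ n, par^[n] a.1 = r) → ∃ n, par^[n] b.1 = r := by
    rintro a b ⟨p⟩
    induction p with
    | nil => exact id
    | cons hab _ ih =>
      intro h1
      refine ih ?_
      obtain ⟨-, h2 | h2⟩ := hab
      · exact (hstep _ _ h2).1 h1
      · exact (hstep _ _ h2).2 h1
  have hreach : ∀ v, ∃ n, par^[n] v = r := fun v =>
    hwalk ⟨r, h.root_mem⟩ ⟨v, huniv ▸ Set.mem_univ v⟩ (h.isTree.connected.preconnected _ _) ⟨0, rfl⟩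
  refine ⟨r, par, fun v => Nat.find (hreach v), Set.mem_univ r, fun _ _ _ => Set.mem_univ _,
    fun v _ hr => T.adj_sub (hpar v hr).1, fun v _ hr => ?_⟩
  have h1 := Nat.find_spec (hreach v)
  rcases hn : Nat.find (hreach v) with _ | n
  · rw [hn] at h1
    exact absurd h1 hr
  · rw [hn] at h1
    exact Nat.lt_succ_of_le (Nat.find_le h1)

/-! ### Attaching a path to an out-tree with many leaves. -/

/-- A two-colouring of `ℕ` in which `j + 1` and `g j` have different colours if `g j ≤ j`. -/
def alternatingColor (g : ℕ → ℕ) : ℕ → Bool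
  | 0 => false
  | j + 1 => if _h : g j ≤ j then !alternatingColor g (g j) else false
termination_by j => j
decreasing_by omega

theorem alternatingColor_succ {g : ℕ → ℕ} {j : ℕ} (h : g j ≤ j) :
    alternatingColor g (j + 1) = !alternatingColor g (g j) := by
  rw [alternatingColor, dif_pos h]

namespace IsArborescence

variable {B : Set V} {r : V} {par : V → V} {ρ : V → ℕ}

/-- An arborescence on `B` extends by the vertices `x j`, `j < m`: the parent of `x j` is
`x (j + 1)` for `j ∈ S`, and `p j` otherwise. -/
theorem exists_extend [Finite V] (h : IsArborescence D B r par ρ) {x p : ℕ → V} {g : ℕ → ℕ}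
    {m : ℕ} (hB : ∀ j < m, x j ∉ B) (hinj : Set.InjOn x (Set.Iio m))
    (hback : ∀ j, j + 1 < m → D.Adj (x (j + 1)) (x j))
    (hp : ∀ j < m, D.Adj (p j) (x j))
    (hg : ∀ j < m, (p j ∈ B ∧ m ≤ g j) ∨ (g j + 2 ≤ j ∧ p j = x (g j)))
    {S : Set ℕ} (hS : ∀ j ∈ S, j + 1 < m ∧ j + 1 ∉ S) :
    ∃ par' ρ', IsArborescence D (B ∪ x '' Set.Iio m) r par' ρ' ∧
      ∀ i < m, (∀ j ∈ S, j + 1 ≠ i) → (∀ j < m, g j = i → j ∈ S) →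
        x i ∈ parentLeaves (B ∪ x '' Set.Iio m) r par' := by
  classical
  obtain ⟨N, hN⟩ : ∃ N, ∀ v, ρ v < N := by
    obtain ⟨N, hN⟩ := (Set.finite_range ρ).bddAbove
    exact ⟨N + 1, fun v => Nat.lt_succ_of_le (hN ⟨v, rfl⟩)⟩
  let idx : V → ℕ := Function.invFunOn x (Set.Iio m)
  have hidx : ∀ j < m, idx (x j) = j := fun j hj =>
    hinj.leftInvOn_invFunOn hj
  let par' : V → V := fun v =>
    if v ∈ B then par v else if idx v ∈ S then x (idx v + 1) else p (idx v)
  -- The offset 3 puts `j ∈ S` above `j + 1 ∉ S`, yet keeps every index up to `j - 2` below `j ∉ S`;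
  -- this is where `g j + 2 ≤ j` matters.
  let ρ' : V → ℕ := fun v =>
    if v ∈ B then ρ v else N + 2 * idx v + if idx v ∈ S then 3 else 0
  have parB : ∀ v ∈ B, par' v = par v := fun v hv => if_pos hv
  have ρB : ∀ v ∈ B, ρ' v = ρ v := fun v hv => if_pos hv
  have parS : ∀ j < m, j ∈ S → par' (x j) = x (j + 1) := fun j hj hjS => by
    simp only [par', if_neg (hB j hj), hidx j hj, if_pos hjS]
  have parN : ∀ j < m, j ∉ S → par' (x j) = p j := fun j hj hjS => by
    simp only [par', if_neg (hB j hj), hidx j hj, if_neg hjS]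
  have ρS : ∀ j < m, j ∈ S → ρ' (x j) = N + 2 * j + 3 := fun j hj hjS => by
    simp only [ρ', if_neg (hB j hj), hidx j hj, if_pos hjS]
  have ρN : ∀ j < m, j ∉ S → ρ' (x j) = N + 2 * j := fun j hj hjS => by
    simp only [ρ', if_neg (hB j hj), hidx j hj, if_neg hjS, add_zero]
  refine ⟨par', ρ', ⟨Or.inl h.root_mem, ?_, ?_, ?_⟩, ?_⟩
  · rintro v (hv | ⟨j, hj, rfl⟩) hr
    · rw [parB v hv]
      exact Or.inl (h.par_mem v hv hr)
    · by_cases hjS : j ∈ S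
      · rw [parS j hj hjS]
        exact Or.inr ⟨j + 1, (hS j hjS).1, rfl⟩
      · rw [parN j hj hjS]
        rcases hg j hj with h1 | h1
        · exact Or.inl h1.1
        · exact Or.inr ⟨g j, by have : j < m := hj; simp only [Set.mem_Iio]; omega, h1.2.symm⟩
  · rintro v (hv | ⟨j, hj, rfl⟩) hr
    · rw [parB v hv]
      exact h.adj v hv hr
    · by_cases hjS : j ∈ S
      · rw [parS j hj hjS]
        exact hback j (hS j hjS).1
      · rw [parN j hj hjS]
        exact hp j hj
  · rintro v (hv | ⟨j, hj, rfl⟩) hr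
    · rw [parB v hv, ρB v hv, ρB _ (h.par_mem v hv hr)]
      exact h.rank_lt v hv hr
    · have hjm : j < m := hj
      by_cases hjS : j ∈ S
      · rw [parS j hj hjS, ρS j hj hjS, ρN _ (hS j hjS).1 (hS j hjS).2]
        omega
      · rw [parN j hj hjS, ρN j hj hjS]
        rcases hg j hj with h1 | h1
        · rw [ρB _ h1.1]
          have := hN (p j)
          omega
        · rw [h1.2]
          by_cases hgS : g j ∈ S
          · rw [ρS _ (by omega) hgS]
            omega
          · rw [ρN _ (by omega) hgS]
            omega
  · intro i hi hi1 hi2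
    refine ⟨Or.inr ⟨i, hi, rfl⟩, ?_⟩
    rintro w (hw | ⟨j, hj, rfl⟩) hr he
    · rw [parB w hw] at he
      exact hB i hi (he ▸ h.par_mem w hw hr)
    · have hjm : j < m := hj
      by_cases hjS : j ∈ S
      · rw [parS j hj hjS] at he
        exact hi1 j hjS (hinj (hS j hjS).1 hi he)
      · rw [parN j hj hjS] at he
        rcases hg j hj with h1 | h1
        · exact hB i hi (he ▸ h1.1)
        · exact hjS (hi2 j hj (hinj (by simp only [Set.mem_Iio]; omega) hi (h1.2 ▸ he)))

/-- If every vertex `x j` of a path `x (m - 1), …, x 0` outside an arborescence on `B` has an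
in-neighbour in `B` or an in-neighbour `x i` with `i + 2 ≤ j`, then some out-tree has at least
`m / 4` leaves. -/
theorem length_le_of_inNeighbors [Finite V] (h : IsArborescence D B r par ρ) {x : ℕ → V}
    {m : ℕ} (hB : ∀ j < m, x j ∉ B) (hinj : Set.InjOn x (Set.Iio m))
    (hback : ∀ j, j + 1 < m → D.Adj (x (j + 1)) (x j))
    (hin : ∀ j < m, (∃ u ∈ B, D.Adj u (x j)) ∨ ∃ i, i + 2 ≤ j ∧ D.Adj (x i) (x j)) :
    m ≤ 4 * D.maxLeaves := by
  classical
  have hex : ∀ j, ∃ u i, j < m → D.Adj u (x j) ∧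
      ((u ∈ B ∧ m ≤ i) ∨ (i + 2 ≤ j ∧ u = x i)) := by
    intro j
    by_cases hj : j < m
    · rcases hin j hj with ⟨u, hu, ha⟩ | ⟨i, hi, ha⟩
      -- The value `m` marks a parent in `B`: it is not the index of a path vertex.
      · exact ⟨u, m, fun _ => ⟨ha, Or.inl ⟨hu, le_rfl⟩⟩⟩
      · exact ⟨x i, i, fun _ => ⟨ha, Or.inr ⟨hi, rfl⟩⟩⟩
    · exact ⟨r, 0, fun h1 => absurd h1 hj⟩
  choose p g hpg using hex
  let χ := alternatingColor g
  -- Indices moved from `x (g j)` to the path neighbour `x (j + 1)`. Fixing the parity excludes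
  -- consecutive indices; as `j + 1` and `g j` differ in colour, no vertex of colour `c.1` gains a
  -- child by such a move.
  let S : Bool × Bool → Set ℕ := fun c =>
    {j | j + 1 < m ∧ g j < j ∧ χ (g j) = c.1 ∧ decide (j % 2 = 1) = c.2}
  let L : Finset (ℕ × Bool) := (Finset.range m ×ˢ Finset.univ).filter fun a =>
    ∀ j < m, g j = a.1 → j ∈ S (χ a.1, a.2)
  -- each class of the pairs counted by `L` consists of leaves of one out-tree
  have hclass : ∀ c ∈ (Finset.univ : Finset (Bool × Bool)),
      (L.filter fun a => (χ a.1, a.2) = c).card ≤ D.maxLeaves := by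
    intro c _
    obtain ⟨par', ρ', h', hleaf⟩ := h.exists_extend hB hinj hback (fun j hj => (hpg j hj).1)
      (fun j hj => (hpg j hj).2) (S := S c) (by
        rintro j ⟨h1, h2, h3, h4⟩
        refine ⟨h1, fun h5 => ?_⟩
        have h6 := h5.2.2.2.trans h4.symm
        rw [decide_eq_decide] at h6
        omega)
    refine le_trans ?_ h'.card_parentLeaves_le
    rw [← Set.ncard_coe_finset]
    refine Set.ncard_le_ncard_of_injOn (fun a => x a.1) ?_ ?_ (Set.toFinite _)
    · intro a ha
      simp only [Finset.coe_filter, Set.mem_ofPred_eq, L, Finset.mem_filter, Finset.mem_product,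
        Finset.mem_range] at ha
      obtain ⟨⟨⟨h1, -⟩, h2⟩, h3⟩ := ha
      refine hleaf _ h1 ?_ ?_
      · rintro j ⟨hj1, hj2, hj3, hj4⟩ he
        have h4 : χ (j + 1) = !χ (g j) := alternatingColor_succ hj2.le
        rw [he, hj3, ← h3] at h4
        simp at h4
      · rw [← h3]
        exact h2
    · intro a ha b hb he
      simp only [Finset.coe_filter, Set.mem_ofPred_eq, L, Finset.mem_filter, Finset.mem_product,
        Finset.mem_range] at ha hb
      refine Prod.ext (hinj ha.1.1.1 hb.1.1.1 he) ?_
      exact (congrArg Prod.snd ha.2).trans (congrArg Prod.snd hb.2).symm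
  have hL : L.card ≤ 4 * D.maxLeaves := by
    rw [Finset.card_eq_sum_card_fiberwise (f := fun a => (χ a.1, a.2)) (t := Finset.univ)
      (fun _ _ => Finset.mem_coe.2 (Finset.mem_univ _))]
    exact (Finset.sum_le_card_nsmul _ _ _ hclass).trans_eq (by simp)
  -- every pair outside `L` is accounted for by some `j < m`
  let F : ℕ → ℕ × Bool := fun j =>
    if j = 0 then (g (m - 1), decide ((m - 1) % 2 = 1)) else (g j, !decide (j % 2 = 1))
  have hcompl : (Finset.range m ×ˢ Finset.univ) \ L ⊆ (Finset.range m).image F := by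
    rintro ⟨i, π⟩ ha
    simp only [L, Finset.mem_sdiff, Finset.mem_filter, not_and, not_forall, Finset.mem_product,
      Finset.mem_range, Finset.mem_univ, and_true] at ha
    obtain ⟨hi, ha⟩ := ha
    obtain ⟨j, hj, rfl, hjS⟩ := ha hi
    have hlt : g j + 2 ≤ j := by
      rcases (hpg j hj).2 with h1 | h1
      · omega
      · exact h1.1
    rw [Finset.mem_image]
    by_cases hπ : decide (j % 2 = 1) = π
    -- With matching parity only the last index fails, having no successor on the path. Its second
    -- pair is charged to index 0, which is free because `g 0 + 2 ≤ 0` is impossible.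
    · have : j = m - 1 := by
        by_contra hne
        exact hjS ⟨by omega, by omega, rfl, hπ⟩
      refine ⟨0, by simp; omega, ?_⟩
      simp only [F, if_true, ← this, hπ]
    · refine ⟨j, by simpa using hj, ?_⟩
      simp only [F, if_neg (show j ≠ 0 by omega)]
      exact Prod.ext rfl (Bool.not_eq.2 hπ)
  -- Of the `2 * m` pairs at most `m` lie outside `L`, so `m ≤ L.card`.
  have h1 := (Finset.card_le_card hcompl).trans Finset.card_image_le
  have h2 := Finset.le_card_sdiff L (Finset.range m ×ˢ (Finset.univ : Finset Bool))
  simp only [Finset.card_product, Finset.card_range, Finset.card_univ, Fintype.card_bool]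
    at h1 h2
  omega

end IsArborescence

/-! ### Descendants and changing the parent of one vertex. -/

/-- `w` is a descendant of `u` (possibly `u` itself) in the tree with root `r` given by `par`. -/
def Descends (r : V) (par : V → V) (u w : V) : Prop :=
  Relation.ReflTransGen (fun a b => b ≠ r ∧ par b = a) u w

namespace Descends

variable {r : V} {par : V → V} {u w : V}

theorem of_par (hw : w ≠ r) (h : Descends r par u (par w)) : Descends r par u w :=
  Relation.ReflTransGen.tail h ⟨hw, rfl⟩

theorem eq_or_par (h : Descends r par u w) : w = u ∨ w ≠ r ∧ Descends r par u (par w) := by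
  rcases Relation.ReflTransGen.cases_tail h with h1 | ⟨c, h1, h2, rfl⟩
  · exact Or.inl h1
  · exact Or.inr ⟨h2, h1⟩

theorem trans {v : V} (h : Descends r par u v) (h' : Descends r par v w) : Descends r par u w :=
  Relation.ReflTransGen.trans h h'

end Descends

namespace IsArborescence

variable {r : V} {par : V → V} {ρ : V → ℕ}

theorem restrict {A B : Set V} (h : IsArborescence D A r par ρ) (hBA : B ⊆ A) {s : V}
    (hs : s ∈ B) (hpar : ∀ v ∈ B, v ≠ s → v ≠ r ∧ par v ∈ B) : IsArborescence D B s par ρ where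
  root_mem := hs
  par_mem v hv hne := (hpar v hv hne).2
  adj v hv hne := h.adj v (hBA hv) (hpar v hv hne).1
  rank_lt v hv hne := h.rank_lt v (hBA hv) (hpar v hv hne).1

theorem rank_lt_of_descends (h : IsArborescence D Set.univ r par ρ) {u w : V}
    (hd : Descends r par u w) (hne : w ≠ u) : ρ u < ρ w := by
  induction hd with
  | refl => exact absurd rfl hne
  | @tail b c _ h2 ih =>
    obtain ⟨h2, rfl⟩ := h2
    have h3 := h.rank_lt c trivial h2
    by_cases he : par c = u
    · rwa [he] at h3
    · exact (ih he).trans h3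

theorem descends_root (h : IsArborescence D Set.univ r par ρ) (w : V) : Descends r par r w := by
  induction hn : ρ w using Nat.strong_induction_on generalizing w with
  | _ n ih =>
    by_cases hw : w = r
    · subst hw
      exact Relation.ReflTransGen.refl
    · exact Descends.of_par hw (ih _ (hn ▸ h.rank_lt w trivial hw) _ rfl)

open Classical in
/-- Replacing the arc into `v` by an arc from a non-descendant of `v`. -/
theorem exists_update [Finite V] (h : IsArborescence D Set.univ r par ρ) {v w : V}
    (hadj : D.Adj w v) (hw : ¬ Descends r par v w) :
    ∃ ρ', IsArborescence D Set.univ r (Function.update par v w) ρ' := by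
  obtain ⟨N, hN⟩ : ∃ N, ∀ v, ρ v < N := by
    obtain ⟨N, hN⟩ := (Set.finite_range ρ).bddAbove
    exact ⟨N + 1, fun v => Nat.lt_succ_of_le (hN ⟨v, rfl⟩)⟩
  -- Lifting the whole subtree of `v` by `N` places it above `w`, which stays below `N`.
  refine ⟨fun x => ρ x + if Descends r par v x then N else 0, trivial, fun _ _ _ => trivial,
    fun x _ hx => ?_, fun x _ hx => ?_⟩
  · by_cases hxv : x = v
    · subst hxv
      rwa [Function.update_self]
    · rw [Function.update_of_ne hxv]
      exact h.adj x trivial hx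
  · by_cases hxv : x = v
    · subst hxv
      have h1 := hN w
      have h2 : Descends r par x x := Relation.ReflTransGen.refl
      rw [Function.update_self, if_neg hw, if_pos h2]
      omega
    · rw [Function.update_of_ne hxv]
      have h1 := h.rank_lt x trivial hx
      by_cases hd : Descends r par v (par x)
      · rw [if_pos hd, if_pos (Descends.of_par hx hd)]
        omega
      · rw [if_neg hd]
        omega

-- The vertex `par v` loses its only child and becomes a leaf, while `w`, the only vertex to gain a
-- child, was not a leaf.
open Classical in
theorem card_parentLeaves_lt_update [Finite V] {v w : V} (hv : v ≠ r) (hpv : w ≠ par v)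
    (hw : w ∉ parentLeaves Set.univ r par) (huniq : ∀ x ≠ r, par x = par v → x = v) :
    (parentLeaves Set.univ r par).ncard <
      (parentLeaves Set.univ r (Function.update par v w)).ncard := by
  refine Set.ncard_lt_ncard ⟨?_, fun hsub => ?_⟩ (Set.toFinite _)
  · rintro u ⟨-, hu⟩
    refine ⟨trivial, fun x _ hx he => ?_⟩
    by_cases hxv : x = v
    · subst hxv
      rw [Function.update_self] at he
      exact hw (he ▸ ⟨trivial, hu⟩)
    · rw [Function.update_of_ne hxv] at he
      exact hu x trivial hx he
  · refine (hsub (a := par v) ⟨trivial, fun x _ hx he => ?_⟩).2 v trivial hv rfl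
    by_cases hxv : x = v
    · subst hxv
      rw [Function.update_self] at he
      exact hpv he
    · rw [Function.update_of_ne hxv] at he
      exact hxv (huniq x hx he)

end IsArborescence

/-! ### Branchless paths in a leaf-maximal arborescence. -/

/-- The vertices `q, par q, …, par^[L] q` form a path of the tree given by `r` and `par`, all of
whose vertices except possibly `q` have exactly one child. -/
def IsBranchlessPath (r : V) (par : V → V) (q : V) (L : ℕ) : Prop :=
  ∀ i < L, par^[i] q ≠ r ∧ ∀ w ≠ r, par w = par^[i + 1] q → w = par^[i] q

namespace IsBranchlessPath

variable {r : V} {par : V → V} {q : V} {L : ℕ}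

theorem descends (hc : IsBranchlessPath r par q L) {i j : ℕ} (hij : i ≤ j) (hj : j ≤ L) :
    Descends r par (par^[j] q) (par^[i] q) := by
  induction j, hij using Nat.le_induction with
  | base => exact Relation.ReflTransGen.refl
  | succ j hij ih =>
    refine Relation.ReflTransGen.head ⟨(hc j hj).1, ?_⟩ (ih (by omega))
    rw [Function.iterate_succ_apply']

theorem eq_or_descends (hc : IsBranchlessPath r par q L) {j : ℕ} (hj : j ≤ L) {w : V}
    (hd : Descends r par (par^[j] q) w) : (∃ i ≤ j, w = par^[i] q) ∨ Descends r par q w := by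
  induction j with
  | zero => exact Or.inr hd
  | succ j ih =>
    rcases Relation.ReflTransGen.cases_head hd with h1 | ⟨z, ⟨hz, hpz⟩, hzw⟩
    · exact Or.inl ⟨j + 1, le_rfl, h1.symm⟩
    · rw [(hc j hj).2 z hz hpz] at hzw
      rcases ih (by omega) hzw with ⟨i, hi, h1⟩ | h1
      · exact Or.inl ⟨i, by omega, h1⟩
      · exact Or.inr h1

theorem rank_lt {ρ : V → ℕ} (hc : IsBranchlessPath r par q L)
    (h : IsArborescence D Set.univ r par ρ) {i j : ℕ} (hij : i < j) (hj : j ≤ L) :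
    ρ (par^[j] q) < ρ (par^[i] q) := by
  induction j, hij using Nat.le_induction with
  | base =>
    rw [Function.iterate_succ_apply']
    exact h.rank_lt _ trivial (hc i hj).1
  | succ j hij ih =>
    refine lt_trans ?_ (ih (by omega))
    rw [Function.iterate_succ_apply']
    exact h.rank_lt _ trivial (hc j hj).1

theorem injOn {ρ : V → ℕ} (hc : IsBranchlessPath r par q L)
    (h : IsArborescence D Set.univ r par ρ) {i j : ℕ} (hi : i ≤ L) (hj : j ≤ L)
    (he : par^[i] q = par^[j] q) : i = j := by
  rcases lt_trichotomy i j with h1 | h1 | h1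
  · exact absurd (congrArg ρ he) (hc.rank_lt h h1 hj).ne'
  · exact h1
  · exact absurd (congrArg ρ he) (hc.rank_lt h h1 hi).ne

end IsBranchlessPath

/-- The in-degree hypothesis, in the form in which it is used: an in-neighbour of `v` other than
a given one `a` and a given vertex `b` that is an out-neighbour. -/
theorem exists_inNeighbor_ne [Finite V]
    (hdeg : (∀ v : V, 3 ≤ D.inDegree v) ∨ (D.IsOriented ∧ ∀ v : V, 2 ≤ D.inDegree v))
    {v b : V} (a : V) (hb : D.Adj v b) : ∃ w, D.Adj w v ∧ w ≠ a ∧ w ≠ b := by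
  rcases hdeg with h | ⟨ho, h⟩
  · have h1 : ({a, b} : Set V).ncard < {u | D.Adj u v}.ncard :=
      ((Set.ncard_insert_le a {b}).trans_eq (by rw [Set.ncard_singleton])).trans_lt (h v)
    obtain ⟨w, hw, hw'⟩ := Set.exists_mem_notMem_of_ncard_lt_ncard h1
    simp only [Set.mem_insert_iff, Set.mem_singleton_iff, not_or] at hw'
    exact ⟨w, hw, hw'⟩
  · have h1 : ({a} : Set V).ncard < {u | D.Adj u v}.ncard := by
      rw [Set.ncard_singleton]
      exact h v
    obtain ⟨w, hw, hw'⟩ := Set.exists_mem_notMem_of_ncard_lt_ncard h1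
    refine ⟨w, hw, hw', ?_⟩
    rintro rfl
    exact ho _ _ hw hb

namespace IsArborescence

variable {r : V} {par : V → V} {ρ : V → ℕ} {q : V} {L : ℕ}

/-- In an arborescence with the maximum number of leaves, an inner vertex of a branchless path
has an in-neighbour outside the subtree of the path, or one below it at distance at least two. -/
theorem exists_inNeighbor_of_path [Finite V] (h : IsArborescence D Set.univ r par ρ)
    (hloopless : ∀ v : V, ¬ D.Adj v v)
    (hdeg : (∀ v : V, 3 ≤ D.inDegree v) ∨ (D.IsOriented ∧ ∀ v : V, 2 ≤ D.inDegree v))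
    (hmax : ∀ par' ρ', IsArborescence D Set.univ r par' ρ' →
      (parentLeaves Set.univ r par').ncard ≤ (parentLeaves Set.univ r par).ncard)
    (hc : IsBranchlessPath r par q L) {j : ℕ} (hj0 : 0 < j) (hjL : j < L) :
    (∃ w, D.Adj w (par^[j] q) ∧ ¬ Descends r par (par^[L] q) w) ∨
      (∃ w, D.Adj w (par^[j] q) ∧ Descends r par q w) ∨
      ∃ i, i + 2 ≤ j ∧ D.Adj (par^[i] q) (par^[j] q) := by
  classical
  obtain ⟨j, rfl⟩ : ∃ j', j = j' + 1 := ⟨j - 1, by omega⟩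
  have hchild : D.Adj (par^[j + 1] q) (par^[j] q) := by
    rw [Function.iterate_succ_apply']
    exact h.adj _ trivial (hc j (by omega)).1
  obtain ⟨w, hw, hwp, hwc⟩ := exists_inNeighbor_ne hdeg (par^[j + 2] q) hchild
  by_cases hd : Descends r par (par^[j + 1] q) w
  · rcases hc.eq_or_descends hjL.le hd with ⟨i, hi, rfl⟩ | h1
    · refine Or.inr (Or.inr ⟨i, ?_, hw⟩)
      have h1 : i ≠ j := fun he => hwc (he ▸ rfl)
      have h2 : i ≠ j + 1 := by
        rintro rfl
        exact hloopless _ hw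
      omega
    · exact Or.inr (Or.inl ⟨w, hw, h1⟩)
  · refine Or.inl ⟨w, hw, fun hdL => ?_⟩
    -- By maximality `w` is a leaf, so it is not a path vertex above `par^[j + 1] q`; those are the
    -- only non-descendants of that vertex in the subtree of the path.
    have hleaf : w ∈ parentLeaves Set.univ r par := by
      by_contra hnl
      obtain ⟨ρ', h'⟩ := h.exists_update hw hd
      have hs : par^[j + 2] q = par (par^[j + 1] q) := Function.iterate_succ_apply' _ _ _
      refine absurd (hmax _ _ h') (not_le.2 (card_parentLeaves_lt_update (hc _ hjL).1
        (hs ▸ hwp) hnl fun x hx he => (hc _ hjL).2 x hx (he.trans hs.symm)))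
    rcases hc.eq_or_descends le_rfl hdL with ⟨i, hi, rfl⟩ | h1
    · by_cases hij : i ≤ j + 1
      · exact hd (hc.descends hij hjL.le)
      · obtain ⟨i, rfl⟩ : ∃ i', i = i' + 1 := ⟨i - 1, by omega⟩
        exact hleaf.2 (par^[i] q) trivial (hc i (by omega)).1
          (Function.iterate_succ_apply' _ _ _).symm
    · exact hd ((hc.descends (Nat.zero_le _) hjL.le).trans h1)

/-- In an arborescence with the maximum number of leaves, branchless paths are short. -/
theorem length_path_le [Finite V] (h : IsArborescence D Set.univ r par ρ)
    (hloopless : ∀ v : V, ¬ D.Adj v v)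
    (hdeg : (∀ v : V, 3 ≤ D.inDegree v) ∨ (D.IsOriented ∧ ∀ v : V, 2 ≤ D.inDegree v))
    (hmax : ∀ par' ρ', IsArborescence D Set.univ r par' ρ' →
      (parentLeaves Set.univ r par').ncard ≤ (parentLeaves Set.univ r par).ncard)
    (hc : IsBranchlessPath r par q L) : L ≤ 8 * D.maxLeaves + 2 := by
  classical
  have hin := fun j h0 hL => h.exists_inNeighbor_of_path hloopless hdeg hmax hc (j := j) h0 hL
  have hadj : ∀ j < L, D.Adj (par^[j + 1] q) (par^[j] q) := by
    intro j hj
    rw [Function.iterate_succ_apply']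
    exact h.adj _ trivial (hc j hj).1
  -- the part of the path below the first vertex with an in-neighbour outside the subtree
  have lower : ∀ b ≤ L, (∀ j, 0 < j → j < b →
      ¬ ∃ w, D.Adj w (par^[j] q) ∧ ¬ Descends r par (par^[L] q) w) →
      b - 1 ≤ 4 * D.maxLeaves := by
    intro b hb hno
    have hbase : IsArborescence D {x | Descends r par q x} q par ρ :=
      h.restrict (Set.subset_univ _) Relation.ReflTransGen.refl
        fun v hv hne => hv.eq_or_par.resolve_left hne
    -- The stretch has indices 1 to `b - 1` and attaches to the subtree of `q`.
    refine hbase.length_le_of_inNeighbors (x := fun j => par^[j + 1] q) ?_ ?_ ?_ ?_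
    · intro j hj hd
      have h1 := hc.rank_lt h (Nat.succ_pos j) (by omega)
      by_cases he : par^[j + 1] q = q
      · rw [he] at h1
        exact lt_irrefl _ h1
      · exact lt_asymm h1 (h.rank_lt_of_descends hd he)
    · intro i hi j hj he
      simp only [Set.mem_Iio] at hi hj
      have := hc.injOn h (by omega) (by omega) he
      omega
    · intro j hj
      exact hadj _ (by omega)
    · intro j hj
      rcases hin (j + 1) (by omega) (by omega) with h1 | ⟨w, h1, h2⟩ | ⟨i, h1, h2⟩
      · exact absurd h1 (hno _ (by omega) (by omega))
      · exact Or.inl ⟨w, h2, h1⟩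
      · rcases i with _ | i
        · exact Or.inl ⟨q, Relation.ReflTransGen.refl, h2⟩
        · exact Or.inr ⟨i, by omega, h2⟩
  by_cases hex : ∃ b, (0 < b ∧ b < L) ∧
      ∃ w, D.Adj w (par^[b] q) ∧ ¬ Descends r par (par^[L] q) w
  · obtain ⟨⟨hb0, hbL⟩, w, hw, hwd⟩ := Nat.find_spec hex
    set b := Nat.find hex with hbdef
    have h1 := lower b hbL.le fun j hj0 hjb hj =>
      Nat.find_min hex hjb ⟨⟨hj0, by omega⟩, hj⟩
    obtain ⟨ρ', h'⟩ := h.exists_update hw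
      fun hd => hwd ((hc.descends hbL.le le_rfl).trans hd)
    have hroot : ¬ Descends r par (par^[L] q) r := by
      intro hd
      rcases hd.eq_or_par with he | h2
      · exact hwd (he ▸ h.descends_root w)
      · exact h2.1 rfl
    -- Hanging `par^[b] q` from `w` joins its subtree to the part outside the subtree of the path;
    -- the stretch with indices `b + 1` to `L - 1` attaches to this out-tree.
    have hbase : IsArborescence D
        {x | ¬ Descends r par (par^[L] q) x ∨ Descends r par (par^[b] q) x} r
        (Function.update par (par^[b] q) w) ρ' := by
      refine h'.restrict (Set.subset_univ _) (Or.inl hroot) fun v hv hne => ⟨hne, ?_⟩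
      by_cases hvb : v = par^[b] q
      · subst hvb
        rw [Function.update_self]
        exact Or.inl hwd
      · rw [Function.update_of_ne hvb]
        rcases hv with hv | hv
        · exact Or.inl fun hd => hv (hd.of_par hne)
        · exact Or.inr (hv.eq_or_par.resolve_left hvb).2
    have h2 := hbase.length_le_of_inNeighbors (x := fun j => par^[b + 1 + j] q)
      (m := L - 1 - b) ?_ ?_ ?_ ?_
    · omega
    · rintro j hj (hd | hd)
      · exact hd (hc.descends (by omega) le_rfl)
      · have h3 := hc.rank_lt h (show b < b + 1 + j by omega) (by omega)
        by_cases he : par^[b + 1 + j] q = par^[b] q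
        · rw [he] at h3
          exact lt_irrefl _ h3
        · exact lt_asymm h3 (h.rank_lt_of_descends hd he)
    · intro i hi j hj he
      simp only [Set.mem_Iio] at hi hj
      have := hc.injOn h (by omega) (by omega) he
      omega
    · intro j hj
      exact hadj (b + 1 + j) (by omega)
    · intro j hj
      rcases hin (b + 1 + j) (by omega) (by omega) with ⟨u, h3, h4⟩ | ⟨u, h3, h4⟩ | ⟨i, h3, h4⟩
      · exact Or.inl ⟨u, Or.inl h4, h3⟩
      · exact Or.inl ⟨u, Or.inr ((hc.descends (Nat.zero_le _) hbL.le).trans h4), h3⟩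
      · by_cases hib : i ≤ b
        · exact Or.inl ⟨_, Or.inr (hc.descends hib hbL.le), h4⟩
        · refine Or.inr ⟨i - (b + 1), by omega, ?_⟩
          rwa [Nat.add_sub_cancel' (by omega)]
  · have h1 := lower L le_rfl fun j h0 hL hj => hex ⟨j, ⟨h0, hL⟩, hj⟩
    omega

/-! ### Counting the vertices. -/

/-- Every vertex is the top of a branchless path whose bottom does not have exactly one child. -/
theorem exists_isBranchlessPath [Finite V] (h : IsArborescence D Set.univ r par ρ) (v : V) :
    ∃ q i, IsBranchlessPath r par q i ∧ v = par^[i] q ∧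
      {w | w ≠ r ∧ par w = q}.ncard ≠ 1 := by
  obtain ⟨N, hN⟩ := (Set.finite_range ρ).bddAbove
  induction hn : N - ρ v using Nat.strong_induction_on generalizing v with
  | _ n ih =>
    by_cases h1 : {w | w ≠ r ∧ par w = v}.ncard = 1
    · obtain ⟨u, hu⟩ := Set.ncard_eq_one.1 h1
      obtain ⟨hur, rfl⟩ : u ∈ {w | w ≠ r ∧ par w = v} := hu ▸ Set.mem_singleton u
      have h2 := h.rank_lt u trivial hur
      have h3 : ρ u ≤ N := hN ⟨u, rfl⟩
      obtain ⟨q, i, hp, he, hq⟩ := ih _ (by omega) u rfl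
      refine ⟨q, i + 1, fun j hj => ?_, by rw [Function.iterate_succ_apply', he], hq⟩
      rcases Nat.lt_succ_iff_lt_or_eq.1 hj with h4 | rfl
      · exact hp j h4
      · rw [Function.iterate_succ_apply', ← he]
        refine ⟨hur, fun w hw hpw => ?_⟩
        have : w ∈ ({u} : Set V) := hu ▸ ⟨hw, hpw⟩
        exact this
    · exact ⟨v, 0, fun i hi => absurd hi (Nat.not_lt_zero i), rfl, h1⟩

/-- In a tree with `k` leaves, at most `2 * k - 1` vertices do not have exactly one child. -/
theorem card_ne_one_child_lt [Fintype V] [DecidableEq V] (r : V) (par : V → V) :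
    (Finset.univ.filter fun v => {w | w ≠ r ∧ par w = v}.ncard ≠ 1).card <
      2 * (parentLeaves Set.univ r par).ncard := by
  have hdeg : ∀ v, {w | w ≠ r ∧ par w = v}.ncard =
      ((Finset.univ.erase r).filter fun w => par w = v).card := by
    intro v
    rw [← Set.ncard_coe_finset]
    congr 1
    ext w
    simp
  have hleaf : (parentLeaves Set.univ r par).ncard =
      (Finset.univ.filter fun v => {w | w ≠ r ∧ par w = v}.ncard = 0).card := by
    rw [← Set.ncard_coe_finset]
    congr 1
    ext v
    simp only [parentLeaves, Set.mem_ofPred_eq, Finset.coe_filter, Finset.mem_univ, true_and,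
      Set.mem_univ, true_implies]
    refine Iff.trans ?_ (Set.ncard_eq_zero (Set.toFinite _)).symm
    simp [Set.eq_empty_iff_forall_notMem]
  have hsum : ∑ v : V, {w | w ≠ r ∧ par w = v}.ncard + 1 = Fintype.card V := by
    simp only [hdeg]
    rw [← Finset.card_eq_sum_card_fiberwise (fun _ _ => Finset.mem_coe.2 (Finset.mem_univ _)),
      Finset.card_erase_add_one (Finset.mem_univ r), Finset.card_univ]
  -- Summed over all vertices, where the child counts add up to n - 1, this gives the bound.
  have hpt : ∀ v : V, 1 + (if {w | w ≠ r ∧ par w = v}.ncard ≠ 1 then 1 else 0) ≤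
      {w | w ≠ r ∧ par w = v}.ncard +
        2 * (if {w | w ≠ r ∧ par w = v}.ncard = 0 then 1 else 0) := by
    intro v
    split_ifs <;> omega
  have htot := Finset.sum_le_sum fun v (_ : v ∈ Finset.univ) => hpt v
  rw [Finset.sum_add_distrib, Finset.sum_add_distrib, ← Finset.mul_sum, ← Finset.card_filter,
    ← Finset.card_filter, ← hleaf, Finset.sum_const, Finset.card_univ, smul_eq_mul, mul_one]
    at htot
  omega

end IsArborescence

/-- Maximality for one fixed root suffices, since the exchange of a parent keeps the root. -/
theorem Subdigraph.IsOutBranching.exists_max_isArborescence [Finite V] {T : D.Subdigraph}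
    (hT : T.IsOutBranching) : ∃ r par ρ, IsArborescence D Set.univ r par ρ ∧
      ∀ par' ρ', IsArborescence D Set.univ r par' ρ' →
        (parentLeaves Set.univ r par').ncard ≤ (parentLeaves Set.univ r par).ncard := by
  obtain ⟨r, par, ρ, h⟩ := hT.exists_isArborescence
  let K : Set ℕ :=
    {k | ∃ par ρ, IsArborescence D Set.univ r par ρ ∧ (parentLeaves Set.univ r par).ncard = k}
  have hb : BddAbove K := by
    refine ⟨D.maxLeaves, ?_⟩
    rintro _ ⟨par', ρ', h', rfl⟩
    exact h'.card_parentLeaves_le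
  obtain ⟨par', ρ', h', he⟩ := Nat.sSup_mem (s := K) ⟨_, par, ρ, h, rfl⟩ hb
  exact ⟨r, par', ρ', h', fun par'' ρ'' h'' => he ▸ le_csSup hb ⟨par'', ρ'', h'', rfl⟩⟩

theorem card_le_sq_maxLeaves [Finite V] (hloopless : ∀ v : V, ¬ D.Adj v v)
    (hbranching : ∃ T : D.Subdigraph, T.IsOutBranching)
    (hdeg : (∀ v : V, 3 ≤ D.inDegree v) ∨ (D.IsOriented ∧ ∀ v : V, 2 ≤ D.inDegree v)) :
    Nat.card V ≤ (4 * D.maxLeaves) ^ 2 := by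
  classical
  have := Fintype.ofFinite V
  obtain ⟨T, hT⟩ := hbranching
  obtain ⟨r, par, ρ, h, hmax⟩ := hT.exists_max_isArborescence
  let Q := Finset.univ.filter fun v => {w | w ≠ r ∧ par w = v}.ncard ≠ 1
  have hQ : Q.card < 2 * D.maxLeaves :=
    (IsArborescence.card_ne_one_child_lt r par).trans_le (Nat.mul_le_mul_left 2 h.card_parentLeaves_le)
  have hcover : (Finset.univ : Finset V) ⊆
      (Q ×ˢ Finset.range (8 * D.maxLeaves + 3)).image fun a => par^[a.2] a.1 := by
    intro v _
    obtain ⟨q, i, hp, rfl, hq⟩ := h.exists_isBranchlessPath v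
    have hi := h.length_path_le hloopless hdeg hmax hp
    exact Finset.mem_image.2 ⟨(q, i), Finset.mem_product.2
      ⟨Finset.mem_filter.2 ⟨Finset.mem_univ _, hq⟩, Finset.mem_range.2 (by simp only; omega)⟩, rfl⟩
  have h1 := (Finset.card_le_card hcover).trans Finset.card_image_le
  rw [Finset.card_univ, Finset.card_product, Finset.card_range] at h1
  rw [Nat.card_eq_fintype_card]
  obtain ⟨k, hk⟩ : ∃ k, D.maxLeaves = k + 1 := ⟨D.maxLeaves - 1, by omega⟩
  rw [hk] at h1 hQ ⊢
  have h2 : Q.card ≤ 2 * k + 1 := by omega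
  nlinarith [Nat.mul_le_mul_right (8 * (k + 1) + 3) h2]

end Digraph

theorem mainTheorem2 {V : Type*} [Finite V] (D : Digraph V)
    (hloopless : ∀ v : V, ¬ D.Adj v v)
    (hbranching : ∃ T : D.Subdigraph, T.IsOutBranching)
    (hdeg : (∀ v : V, 3 ≤ D.inDegree v) ∨
      (D.IsOriented ∧ ∀ v : V, 2 ≤ D.inDegree v)) :
    (1 / 4 : ℝ) * Real.sqrt (Nat.card V : ℝ) ≤ (D.maxLeaves : ℝ) := by
  have h : (Nat.card V : ℝ) ≤ (4 * D.maxLeaves : ℝ) ^ 2 := by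
    exact_mod_cast Digraph.card_le_sq_maxLeaves hloopless hbranching hdeg
  have h1 : Real.sqrt (Nat.card V : ℝ) ≤ 4 * D.maxLeaves :=
    Real.sqrt_le_iff.2 ⟨by positivity, h⟩
  linarith
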